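/- Let $\lambda,\gamma,t_0>0$ and let $g:\mathbb{R}^n\to\mathbb{R}$ be a (possibly nonconvex) Fréchet differentiable function that is bounded from below and whose gradient is $L_g$-Lipschitz continuous. For $u_0,v_0\in\mathbb{R}^n$, let $x:[t_0,+\infty)\to\mathbb{R}^n$ be the unique strong global solution of $$\frac{\lambda}{t^2}\ddot x(t)+\frac{\gamma}{t}\dot x(t)+\nabla g(x(t))=0,\qquad x(t_0)=u_0,\quad \dot x(t_0)=v_0,$$ that is, $x,\dot x,\ddot x$ are absolutely continuous on every interval $[t_0,b]$, $b>t_0$, the differential equation holds for almost every $t\ge t_0$, and the initial conditions hold. Consider $$H:\mathbb{R}^n\times\mathbb{R}^n\to\mathbb{R},\qquad H(u,v)=g(u)+\tfrac12\|u-v\|^2 .$$ Suppose that $x$ is bounded, and let $\overline x$ be a critical point of $g$ (i.e. $\nabla g(\overline x)=0$) such that $\lim_{t\to+\infty}x(t)=\overline x$ and such that $H$ has the Łojasiewicz property at its critical point $(\overline x,\overline x)$ with exponent $\theta\in(0,1)$: there exist $K,\varepsilon>0$ with $$|H(p)-H(\overline x,\overline x)|^{\theta}\le K\|\nabla H(p)\|\quad\text{for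 all } p\in\mathbb{R}^n\times\mathbb{R}^n \text{ with } \|p-(\overline x,\overline x)\|<\varepsilon .$$ Then there exist $a_1,a_2,a_3,a_4>0$ and $t'>0$ with $t'\ge t_0$ such that for every $t\in[t',+\infty)$ the following statements are true: (a) if $\theta\in(0,\frac12)$, then $x$ converges in finite time, i.e. there is $T\ge t_0$ with $x(s)=\overline x$ for all $s\ge T$; (b) if $\theta=\frac12$, then $\|x(t)-\overline x\|\le a_1e^{-a_2t^2}$; (c) if $\theta\in(\frac12,1)$, then $\|x(t)-\overline x\|\le (a_3t^2+a_4)^{-\frac{1-\theta}{2\theta-1}}$. -/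

import Mathlib

open Set Filter Topology MeasureTheory
open scoped NNReal Gradient

noncomputable section

/-- The Euclidean space `ℝⁿ`. -/
abbrev Rn (n : ℕ) : Type := EuclideanSpace ℝ (Fin n)

/-- The product `ℝⁿ × ℝⁿ` with its Euclidean (Hilbert) norm `‖(u, v)‖² = ‖u‖² + ‖v‖²`. -/
abbrev RnRn (n : ℕ) : Type := WithLp 2 (Rn n × Rn n)

/-- The set of critical points of a real function on a Hilbert space. -/
def crit {F : Type*} [NormedAddCommGroup F] [InnerProductSpace ℝ F] [CompleteSpace F]
    (f : F → ℝ) : Set F :=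
  {p | ∇ f p = 0}

/-- The regularization `H(u, v) = g(u) + ½ ‖u - v‖²` of `g`. -/
def regularization {n : ℕ} (g : Rn n → ℝ) (p : RnRn n) : ℝ :=
  g p.fst + 1 / 2 * ‖p.fst - p.snd‖ ^ 2

/-- The differentiable function `f` fulfils the Łojasiewicz property at its critical point `p₀` with
Łojasiewicz exponent `θ ∈ (0, 1)`. -/
structure LojasiewiczAt {F : Type*} [NormedAddCommGroup F] [InnerProductSpace ℝ F]
    [CompleteSpace F] (f : F → ℝ) (p₀ : F) (θ : ℝ) : Prop where
  differentiable : Differentiable ℝ f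
  mem_crit : p₀ ∈ crit f
  exponent_mem : θ ∈ Ioo (0 : ℝ) 1
  inequality : ∃ K > (0 : ℝ), ∃ ε > (0 : ℝ), ∀ p : F, ‖p - p₀‖ < ε →
    |f p - f p₀| ^ θ ≤ K * ‖∇ f p‖

/-- A function on `[t₀, +∞)` is locally absolutely continuous if it is absolutely continuous on
every interval `[t₀, b]`. -/
def LocallyAbsolutelyContinuous {n : ℕ} (t₀ : ℝ) (x : ℝ → Rn n) : Prop :=
  ∀ b > t₀, AbsolutelyContinuousOnInterval x t₀ b

/-- The derivative of a function defined on `[t₀, +∞)` (one-sided at `t₀`). Only the values of `x`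
on `[t₀, +∞)` matter for its values there. -/
def dot {n : ℕ} (t₀ : ℝ) (x : ℝ → Rn n) : ℝ → Rn n :=
  derivWithin x (Ici t₀)

/-- `x : [t₀, +∞) → ℝⁿ` is a strong global solution of
`(lam / t²) x'' + (gam / t) x' + ∇ g (x) = 0`, `x(t₀) = u₀`, `x'(t₀) = v₀`. The trajectory is
a total function of which only the restriction to `[t₀, +∞)` is used. -/
structure IsStrongGlobalSolution {n : ℕ} (g : Rn n → ℝ) (lam gam t₀ : ℝ) (u₀ v₀ : Rn n)
    (x : ℝ → Rn n) : Prop where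
  ac : LocallyAbsolutelyContinuous t₀ x
  ac_dot : LocallyAbsolutelyContinuous t₀ (dot t₀ x)
  ac_ddot : LocallyAbsolutelyContinuous t₀ (dot t₀ (dot t₀ x))
  ode : ∀ᵐ t ∂(volume.restrict (Ici t₀)),
    (lam / t ^ 2) • dot t₀ (dot t₀ x) t + (gam / t) • dot t₀ x t + ∇ g (x t) = 0
  init : x t₀ = u₀
  init_dot : dot t₀ x t₀ = v₀

/-- `x : [t₀, +∞) → ℝⁿ` converges to `xbar` in finite time: it reaches `xbar` and stays there. -/
def ConvergesInFiniteTime {n : ℕ} (t₀ : ℝ) (x : ℝ → Rn n) (xbar : Rn n) : Prop :=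
  ∃ T ≥ t₀, ∀ t ≥ T, x t = xbar

end

/-! In the time scale `s = t² / 2`, with `y(s) = x(t)` and `v = y' = x'(t) / t`, the equation
becomes `lam y'' + (gam + lam / (2s)) y' + ∇ g (y) = 0`. Its damping is bounded and bounded away
from zero, so the vanishing coefficients disappear and rates in `s` become rates in `t²`.

The mechanical energy alone dissipates only `‖v‖²`. Evaluating `g` at `y + δ v` with small `δ` adds
dissipation of `‖∇ g (y)‖²`: for `φ = g(y + δ v) + (lam / 2) ‖v‖² - g(xbar)` and `m = ‖v‖ + ‖∇ g
(y)‖`, `exists_energy_decay` gives `φ' ≤ -c m²`. Moreover `φ` is a value of `H` minus its critical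
value, so the Łojasiewicz inequality gives `|φ|^θ ≤ C m`.

Hence either `φ` vanishes at some time and the motion stops, or `φ > 0`, `φ' ≤ -k φ^(2θ)` and `φ^(1
- θ)` bounds the remaining path length (`eventually_eq_or_forall_norm_sub_le`). Integrating this
inequality excludes the second case for `θ < 1/2` and gives the two rates otherwise. -/

/-! ### Regularity of strong solutions. -/

/-- A locally absolutely continuous function whose one-sided derivative is continuous is
differentiable on the interior of its domain. -/
theorem hasDerivAt_derivWithin_of_absolutelyContinuous {F : Type*} [NormedAddCommGroup F]
    [NormedSpace ℝ F] [FiniteDimensional ℝ F] {f : ℝ → F} {t₀ : ℝ}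
    (hf : ∀ b > t₀, AbsolutelyContinuousOnInterval f t₀ b)
    (hc : ContinuousOn (derivWithin f (Ici t₀)) (Ici t₀)) {t : ℝ} (ht : t₀ < t) :
    HasDerivAt f (derivWithin f (Ici t₀) t) t := by
  -- The derivative is extended to the left of `t₀` by its value there, making it continuous on all
  -- of `ℝ`.
  set w : ℝ → F := fun s => derivWithin f (Ici t₀) (max t₀ s) with hw
  have hwc : Continuous w :=
    hc.comp_continuous (by fun_prop) fun s => le_max_left t₀ s
  have hI : ∀ s, HasDerivAt (fun s => ∫ r in t₀..s, w r) (w s) s := fun s =>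
    intervalIntegral.integral_hasDerivAt_right (hwc.intervalIntegrable _ _)
      (hwc.stronglyMeasurableAtFilter _ _) hwc.continuousAt
  have hIC : ContDiff ℝ 1 (fun s => ∫ r in t₀..s, w r) := by
    rw [contDiff_one_iff_deriv]
    refine ⟨fun s => (hI s).differentiableAt, ?_⟩
    rwa [show deriv (fun s => ∫ r in t₀..s, w r) = w from funext fun s => (hI s).deriv]
  have hb : t₀ < t + 1 := by linarith
  have hfac := hf (t + 1) hb
  -- `f` minus the primitive of `w` is absolutely continuous with a.e. zero derivative.
  obtain ⟨C, hC⟩ := (hfac.sub (hIC.contDiffOn.absolutelyContinuousOnInterval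
    (a := t₀) (b := t + 1))).const_of_ae_hasDerivAt_zero (by
      have h1 := hfac.boundedVariationOn.locallyBoundedVariationOn.ae_differentiableWithinAt_of_mem
      have h2 : ∀ᵐ s : ℝ, s ≠ t₀ ∧ s ≠ t + 1 :=
        (Measure.ae_ne volume t₀).and (Measure.ae_ne volume (t + 1))
      filter_upwards [h1, h2] with s hs hne hmem
      have hmem' := hmem
      rw [uIcc_of_le hb.le] at hmem'
      have hlt : t₀ < s := lt_of_le_of_ne hmem'.1 (Ne.symm hne.1)
      have hlt' : s < t + 1 := lt_of_le_of_ne hmem'.2 hne.2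
      have hd : DifferentiableAt ℝ f s := (hs hmem).differentiableAt (by
        rw [uIcc_of_le hb.le]; exact Icc_mem_nhds hlt hlt')
      have hd' : HasDerivAt f (w s) s := by
        simp only [hw, max_eq_right hlt.le]
        rw [derivWithin_of_mem_nhds (Ici_mem_nhds hlt)]
        exact hd.hasDerivAt
      simpa using hd'.sub (hI s))
  have heq : f =ᶠ[𝓝 t] fun s => C + ∫ r in t₀..s, w r := by
    filter_upwards [Ioo_mem_nhds ht (lt_add_one t)] with s hs
    have := hC s (by rw [uIcc_of_le hb.le]; exact ⟨hs.1.le, hs.2.le⟩)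
    rw [← this]; simp
  have := ((hI t).const_add C).congr_of_eventuallyEq heq
  simpa [hw, max_eq_right ht.le] using this

theorem LocallyAbsolutelyContinuous.continuousOn {n : ℕ} {t₀ : ℝ} {x : ℝ → Rn n}
    (hx : LocallyAbsolutelyContinuous t₀ x) : ContinuousOn x (Ici t₀) := by
  intro t ht
  have hlt : t₀ < t + 1 := lt_of_le_of_lt ht (lt_add_one t)
  have h := (hx (t + 1) hlt).continuousOn
  rw [uIcc_of_le hlt.le] at h
  exact (h t ⟨ht, by linarith⟩).mono_of_mem_nhdsWithin
    (mem_nhdsWithin.2 ⟨Iio (t + 1), isOpen_Iio, lt_add_one t, fun s hs => ⟨hs.2, hs.1.le⟩⟩)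

namespace IsStrongGlobalSolution

variable {n : ℕ} {g : Rn n → ℝ} {lam gam t₀ : ℝ} {u₀ v₀ : Rn n} {x : ℝ → Rn n}

theorem hasDerivAt (hx : IsStrongGlobalSolution g lam gam t₀ u₀ v₀ x) {t : ℝ} (ht : t₀ < t) :
    HasDerivAt x (dot t₀ x t) t :=
  hasDerivAt_derivWithin_of_absolutelyContinuous hx.ac hx.ac_dot.continuousOn ht

theorem hasDerivAt_dot (hx : IsStrongGlobalSolution g lam gam t₀ u₀ v₀ x) {t : ℝ}
    (ht : t₀ < t) : HasDerivAt (dot t₀ x) (dot t₀ (dot t₀ x) t) t :=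
  hasDerivAt_derivWithin_of_absolutelyContinuous hx.ac_dot hx.ac_ddot.continuousOn ht

/-- By continuity, the differential equation holds everywhere. -/
theorem ode_of_lt (hx : IsStrongGlobalSolution g lam gam t₀ u₀ v₀ x) (hg : Continuous (∇ g))
    (ht₀ : 0 < t₀) {t : ℝ} (ht : t₀ < t) :
    (lam / t ^ 2) • dot t₀ (dot t₀ x) t + (gam / t) • dot t₀ x t + ∇ g (x t) = 0 := by
  have hne : ∀ s ∈ Ioi t₀, s ≠ 0 := fun s hs => (ht₀.trans hs).ne'
  have h0 : ContinuousOn x (Ioi t₀) := hx.ac.continuousOn.mono Ioi_subset_Ici_self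
  have h1 : ContinuousOn (dot t₀ x) (Ioi t₀) := hx.ac_dot.continuousOn.mono Ioi_subset_Ici_self
  have h2 : ContinuousOn (dot t₀ (dot t₀ x)) (Ioi t₀) :=
    hx.ac_ddot.continuousOn.mono Ioi_subset_Ici_self
  have h3 : ContinuousOn (fun s => lam / s ^ 2) (Ioi t₀) :=
    continuousOn_const.div (continuousOn_pow 2) fun s hs => pow_ne_zero 2 (hne s hs)
  have h4 : ContinuousOn (fun s => gam / s) (Ioi t₀) :=
    continuousOn_const.div continuousOn_id hne
  have hc := ((h3.smul h2).add (h4.smul h1)).add (hg.comp_continuousOn h0)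
  have hae := ae_mono (Measure.restrict_mono (Ioi_subset_Ici_self (a := t₀)) le_rfl) hx.ode
  exact MeasureTheory.Measure.eqOn_open_of_ae_eq hae isOpen_Ioi hc
    (continuousOn_const (c := (0 : Rn n))) ht

end IsStrongGlobalSolution

/-! ### The regularization `H`. -/

theorem hasGradientAt_regularization {n : ℕ} {g : Rn n → ℝ} (hg : Differentiable ℝ g)
    (p : RnRn n) : HasGradientAt (regularization g)
      (WithLp.toLp 2 (∇ g p.fst + (p.fst - p.snd), p.snd - p.fst)) p := by
  rw [hasGradientAt_iff_hasFDerivAt]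
  have h1 : HasFDerivAt (fun q : RnRn n => q.fst) (WithLp.fstL 2 ℝ (Rn n) (Rn n)) p :=
    (WithLp.fstL 2 ℝ (Rn n) (Rn n)).hasFDerivAt
  have h2 : HasFDerivAt (fun q : RnRn n => q.snd) (WithLp.sndL 2 ℝ (Rn n) (Rn n)) p :=
    (WithLp.sndL 2 ℝ (Rn n) (Rn n)).hasFDerivAt
  have h3 := (hasGradientAt_iff_hasFDerivAt.1 (hg p.fst).hasGradientAt).comp p h1
  have h4 := ((h1.sub h2).norm_sq).const_mul (1 / 2 : ℝ)
  convert! h3.add h4 using 1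
  ext q
  simp [WithLp.prod_inner_apply, inner_sub_left, inner_add_left]
  ring

/-- The Łojasiewicz property of the regularization, written in the variables `u` and `w = u - v`. -/
theorem LojasiewiczAt.exists_forall_abs_rpow_le {n : ℕ} {g : Rn n → ℝ} {xbar : Rn n} {θ : ℝ}
    (hg : Differentiable ℝ g)
    (hH : LojasiewiczAt (regularization g) (WithLp.toLp 2 (xbar, xbar)) θ) :
    ∃ K > (0 : ℝ), ∃ ε > (0 : ℝ), ∀ u w : Rn n, ‖u - xbar‖ < ε → ‖w‖ < ε →
      |g u + 1 / 2 * ‖w‖ ^ 2 - g xbar| ^ θ ≤ K * (‖∇ g u‖ + ‖w‖) := by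
  have hnorm : ∀ q : RnRn n, ‖q‖ ≤ ‖q.fst‖ + ‖q.snd‖ := fun q => by
    have := WithLp.prod_norm_sq_eq_of_L2 q
    nlinarith [norm_nonneg q, norm_nonneg q.fst, norm_nonneg q.snd,
      mul_nonneg (norm_nonneg q.fst) (norm_nonneg q.snd)]
  obtain ⟨K, hK, ε, hε, h⟩ := hH.inequality
  -- At `(u, u - w)` the gradient of `H` is `(∇ g u + w, -w)`, of norm at most `‖∇ g u‖ + 2 ‖w‖`;
  -- the distance to `(xbar, xbar)` is at most `2 ‖u - xbar‖ + ‖w‖`.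
  refine ⟨2 * K, by positivity, ε / 3, by positivity, fun u w hu hw => ?_⟩
  have h1 := h (WithLp.toLp 2 (u, u - w)) (by
    refine (hnorm _).trans_lt ?_
    have : ‖u - w - xbar‖ ≤ ‖u - xbar‖ + ‖w‖ := by
      rw [sub_right_comm]; exact norm_sub_le _ _
    simp only [WithLp.sub_fst, WithLp.sub_snd, WithLp.toLp_fst, WithLp.toLp_snd]
    linarith)
  rw [(hasGradientAt_regularization hg _).gradient] at h1
  simp [regularization] at h1
  rw [one_div]
  refine h1.trans ?_
  rw [mul_comm 2 K, mul_assoc]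
  gcongr
  refine (hnorm _).trans ?_
  have := norm_add_le (∇ g u) w
  simp
  linarith [norm_nonneg (∇ g u)]

/-! ### Linear differential inequalities. -/

theorem antitoneOn_Ici_of_hasDerivAt_nonpos {f f' : ℝ → ℝ} {S : ℝ}
    (hf : ∀ s ≥ S, HasDerivAt f (f' s) s) (hf' : ∀ s ≥ S, f' s ≤ 0) : AntitoneOn f (Ici S) := by
  refine antitoneOn_of_deriv_nonpos (convex_Ici S)
    (fun s hs => (hf s hs).continuousAt.continuousWithinAt)
    (fun s hs => (hf s (interior_subset hs)).differentiableAt.differentiableWithinAt)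
    fun s hs => ?_
  rw [(hf s (interior_subset hs)).deriv]
  exact hf' s (interior_subset hs)

/-- Grönwall-type bound for `q' ≤ -α q`. -/
theorem le_mul_exp_of_hasDerivAt_le {q q' : ℝ → ℝ} {α S : ℝ}
    (hq : ∀ s ≥ S, HasDerivAt q (q' s) s) (h : ∀ s ≥ S, q' s ≤ -α * q s) :
    ∀ s ≥ S, q s ≤ q S * Real.exp (α * S) * Real.exp (-α * s) := by
  intro s hs
  have hexp : ∀ r, HasDerivAt (fun r => Real.exp (α * r)) (Real.exp (α * r) * α) r := fun r => by
    simpa using ((hasDerivAt_id r).const_mul α).exp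
  have hanti := antitoneOn_Ici_of_hasDerivAt_nonpos (fun r hr => (hq r hr).mul (hexp r))
    (fun r hr => by nlinarith [h r hr, Real.exp_pos (α * r)])
  have := hanti self_mem_Ici hs hs
  simp only [Pi.mul_apply] at this
  calc q s = q s * Real.exp (α * s) * Real.exp (-α * s) := by
        rw [mul_assoc, ← Real.exp_add]; simp
    _ ≤ _ := by gcongr

/-- A nonnegative solution of `q' ≤ -α q + e` with `e → 0` tends to zero. -/
theorem tendsto_zero_of_hasDerivAt_le {q q' e : ℝ → ℝ} {α S : ℝ} (hα : 0 < α)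
    (hq0 : ∀ s, 0 ≤ q s) (hq : ∀ s ≥ S, HasDerivAt q (q' s) s)
    (h : ∀ s ≥ S, q' s ≤ -α * q s + e s) (he : Tendsto e atTop (𝓝 0)) :
    Tendsto q atTop (𝓝 0) := by
  refine tendsto_order.2 ⟨fun b hb => Eventually.of_forall fun s => hb.trans_le (hq0 s),
    fun b hb => ?_⟩
  obtain ⟨R, hR⟩ := eventually_atTop.1 (he.eventually_lt_const (show 0 < α * (b / 2) by positivity))
  -- Once `e < α b / 2`, the shifted function `q - b / 2` satisfies the homogeneous inequality.
  have hbound := le_mul_exp_of_hasDerivAt_le (q := fun s => q s - b / 2) (q' := q') (α := α)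
    (S := max S R) (fun s hs => (hq s (le_of_max_le_left hs)).sub_const _) (fun s hs => by
      have h1 := h s (le_of_max_le_left hs)
      have h2 := hR s (le_of_max_le_right hs)
      linarith)
  have hexp : Tendsto (fun s => (q (max S R) - b / 2) * Real.exp (α * max S R)
      * Real.exp (-α * s)) atTop (𝓝 0) := by
    have : Tendsto (fun s => -α * s) atTop atBot := tendsto_id.const_mul_atTop_of_neg (by linarith)
    simpa using (Real.tendsto_exp_atBot.comp this).const_mul
      ((q (max S R) - b / 2) * Real.exp (α * max S R))
  filter_upwards [hexp.eventually_lt_const (half_pos hb), eventually_ge_atTop (max S R)] with s h1 h2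
  have := hbound s h2
  linarith

/-! ### The Łojasiewicz argument. -/

section Lojasiewicz

variable {E : Type*} [NormedAddCommGroup E] [NormedSpace ℝ E]
  {φ φ' m : ℝ → ℝ} {y v : ℝ → E} {ybar : E} {c C θ S : ℝ}

/-- The Łojasiewicz dichotomy: along a trajectory `y` of speed at most `m` on which `φ` decreases at
rate `c m²` and `|φ|^θ ≤ C m`, either `y` reaches its limit in finite time, or `φ` stays positive,
decays like a solution of `φ' = -k φ^(2θ)` and controls the distance to the limit. -/
theorem eventually_eq_or_forall_norm_sub_le (hc : 0 < c) (hC : 0 < C) (hθ : θ ∈ Ioo (0 : ℝ) 1)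
    (hφ : ∀ s ≥ S, HasDerivAt φ (φ' s) s) (hdec : ∀ s ≥ S, φ' s ≤ -c * m s ^ 2)
    (hL : ∀ s ≥ S, |φ s| ^ θ ≤ C * m s) (hy : ∀ s ≥ S, HasDerivAt y (v s) s)
    (hv : ∀ s ≥ S, ‖v s‖ ≤ m s) (hφ0 : Tendsto φ atTop (𝓝 0)) (hylim : Tendsto y atTop (𝓝 ybar)) :
    (∃ T, ∀ s ≥ T, y s = ybar) ∨
      ∀ s ≥ S, 0 < φ s ∧ φ' s ≤ -(c / C ^ 2) * φ s ^ (2 * θ) ∧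
        ‖y s - ybar‖ ≤ C / (c * (1 - θ)) * φ s ^ (1 - θ) := by
  have hθ1 : 0 < 1 - θ := sub_pos.2 hθ.2
  have hanti : AntitoneOn φ (Ici S) := antitoneOn_Ici_of_hasDerivAt_nonpos hφ fun s hs => by
    nlinarith [hdec s hs, sq_nonneg (m s)]
  have hnonneg : ∀ s ≥ S, 0 ≤ φ s := fun s hs => le_of_tendsto hφ0 (by
    filter_upwards [eventually_ge_atTop s] with r hr
    exact hanti hs (hs.trans hr) hr)
  have hycont : ContinuousOn y (Ici S) := fun s hs => (hy s hs).continuousAt.continuousWithinAt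
  by_cases hzero : ∃ T ≥ S, φ T = 0
  · left
    obtain ⟨T, hTS, hT⟩ := hzero
    have hφT : ∀ s ≥ T, φ s = 0 := fun s hs =>
      le_antisymm (hT ▸ hanti hTS (hTS.le.trans hs) hs) (hnonneg s (hTS.le.trans hs))
    -- Past `T`, `φ` vanishes on a full neighbourhood of `s`, so its two-sided derivative is zero,
    -- which forces `m s = 0`.
    have hv0 : ∀ s ≥ T + 1, v s = 0 := fun s hs => by
      have hsS : S ≤ s := by linarith
      have hder : HasDerivAt φ 0 s := (hasDerivAt_const s (0 : ℝ)).congr_of_eventuallyEq (by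
        filter_upwards [Ioi_mem_nhds (show T < s by linarith)] with r hr using hφT r (le_of_lt hr))
      have h0 : φ' s = 0 := (hφ s hsS).unique hder
      have h1 := hdec s hsS
      have h2 : m s ^ 2 ≤ 0 := by nlinarith
      have h3 : m s = 0 := pow_eq_zero_iff two_ne_zero |>.1 (le_antisymm h2 (sq_nonneg _))
      exact norm_le_zero_iff.1 (h3 ▸ hv s hsS)
    have hconst : ∀ s ≥ T + 1, y s = y (T + 1) := fun s hs =>
      constant_of_has_deriv_right_zero (a := T + 1) (b := s)
        (hycont.mono fun r hr => by have := hr.1; simp only [mem_Ici]; linarith)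
        (fun r hr => by
          have := hy r (by linarith [hr.1])
          rw [hv0 r hr.1] at this
          exact this.hasDerivWithinAt) s ⟨hs, le_rfl⟩
    have hlim : y (T + 1) = ybar := by
      refine tendsto_nhds_unique (tendsto_const_nhds.congr' ?_) hylim
      filter_upwards [eventually_ge_atTop (T + 1)] with s hs using (hconst s hs).symm
    exact ⟨T + 1, fun s hs => (hconst s hs).trans hlim⟩
  · right
    have hpos : ∀ s ≥ S, 0 < φ s := fun s hs =>
      lt_of_le_of_ne (hnonneg s hs) fun h => hzero ⟨s, hs, h.symm⟩
    have hL' : ∀ s ≥ S, φ s ^ θ ≤ C * m s := fun s hs => by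
      simpa [abs_of_pos (hpos s hs)] using hL s hs
    intro s hs
    refine ⟨hpos s hs, ?_, ?_⟩
    · have h1 : φ s ^ (2 * θ) = (φ s ^ θ) ^ 2 := by
        rw [mul_comm, Real.rpow_mul (hpos s hs).le]; norm_cast
      have h2 : (φ s ^ θ) ^ 2 ≤ (C * m s) ^ 2 := by
        have := hL' s hs
        have := Real.rpow_nonneg (hpos s hs).le θ
        gcongr
      have h3 : c / C ^ 2 * (φ s ^ θ) ^ 2 ≤ c * m s ^ 2 := by
        calc c / C ^ 2 * (φ s ^ θ) ^ 2 ≤ c / C ^ 2 * (C * m s) ^ 2 := by gcongr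
          _ = c * m s ^ 2 := by field_simp
      rw [h1]
      linarith [hdec s hs]
    -- Desingularization: `-(φ^(1 - θ))' ≥ (1 - θ) c m² φ^(-θ) ≥ m / k`, so `k φ^(1 - θ)` decreases
    -- at least as fast as `y` moves.
    · set k := C / (c * (1 - θ)) with hk
      have hk0 : 0 < k := by positivity
      have hBder : ∀ r ≥ S, HasDerivAt (fun r => k * (φ s ^ (1 - θ) - φ r ^ (1 - θ)))
          (k * -(φ' r * (1 - θ) * φ r ^ (1 - θ - 1))) r := fun r hr =>
        (((hφ r hr).rpow_const (Or.inl (hpos r hr).ne')).const_sub _).const_mul k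
      have hbound : ∀ r ≥ S, ‖v r‖ ≤ k * -(φ' r * (1 - θ) * φ r ^ (1 - θ - 1)) := fun r hr => by
        have hp := Real.rpow_pos_of_pos (hpos r hr) θ
        have hm : 0 ≤ m r := (norm_nonneg _).trans (hv r hr)
        have h1 : φ r ^ (1 - θ - 1) = (φ r ^ θ)⁻¹ := by
          rw [← Real.rpow_neg (hpos r hr).le]; congr 1; ring
        rw [h1]
        refine (hv r hr).trans ?_
        have h2 : m r * φ r ^ θ ≤ m r * (C * m r) := by gcongr; exact hL' r hr
        have h3 : m r * φ r ^ θ * c ≤ C * -φ' r := by nlinarith [hdec r hr]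
        have h4 : k * -(φ' r * (1 - θ) * (φ r ^ θ)⁻¹) = C * -φ' r / c / φ r ^ θ := by
          rw [hk]; field_simp
        rw [h4, le_div_iff₀ hp, le_div_iff₀ hc]
        exact h3
      have hdist : ∀ r ≥ s, ‖y s - y r‖ ≤ k * φ s ^ (1 - θ) := fun r hr => by
        have := image_norm_le_of_norm_deriv_right_le_deriv_boundary'
          (f := fun r => y r - y s) (f' := v) (a := s) (b := r)
          (B := fun r => k * (φ s ^ (1 - θ) - φ r ^ (1 - θ)))
          (B' := fun r => k * -(φ' r * (1 - θ) * φ r ^ (1 - θ - 1)))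
          (fun τ hτ => ((hy τ (hs.le.trans hτ.1)).sub_const _).continuousAt.continuousWithinAt)
          (fun τ hτ => ((hy τ (hs.le.trans hτ.1)).sub_const _).hasDerivWithinAt) (by simp)
          (fun τ hτ => (hBder τ (hs.le.trans hτ.1)).continuousAt.continuousWithinAt)
          (fun τ hτ => (hBder τ (hs.le.trans hτ.1)).hasDerivWithinAt)
          (fun τ hτ => hbound τ (hs.le.trans hτ.1)) (right_mem_Icc.2 hr)
        rw [norm_sub_rev]
        refine this.trans ?_
        have := Real.rpow_nonneg (hnonneg r (hs.le.trans hr)) (1 - θ)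
        gcongr
        linarith
      refine le_of_tendsto (hylim.const_sub (y s)).norm ?_
      filter_upwards [eventually_ge_atTop s] with r hr using hdist r hr

end Lojasiewicz

/-! ### Integration of `φ' ≤ -k φ^p`. -/

section Rates

variable {E : Type*} [NormedAddCommGroup E] {φ φ' : ℝ → ℝ} {y : ℝ → E} {ybar : E} {θ S k M : ℝ}

/-- A positive function cannot satisfy `φ' ≤ -k φ^p` with `p < 1` for all times. -/
theorem false_of_hasDerivAt_le_rpow {p : ℝ} (hk : 0 < k) (hp : p < 1)
    (hφ : ∀ s ≥ S, HasDerivAt φ (φ' s) s) (hpos : ∀ s ≥ S, 0 < φ s)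
    (h : ∀ s ≥ S, φ' s ≤ -k * φ s ^ p) : False := by
  have hanti := antitoneOn_Ici_of_hasDerivAt_nonpos
    (f := fun s => φ s ^ (1 - p) + (1 - p) * k * s) (S := S)
    (fun s hs => ((hφ s hs).rpow_const (Or.inl (hpos s hs).ne')).add
      ((hasDerivAt_id s).const_mul ((1 - p) * k))) fun s hs => by
      have h1 : φ s ^ (1 - p - 1) = (φ s ^ p)⁻¹ := by
        rw [← Real.rpow_neg (hpos s hs).le]; congr 1; ring
      have hp0 := Real.rpow_pos_of_pos (hpos s hs) p
      have h2 : φ' s * (φ s ^ p)⁻¹ ≤ -k := by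
        rw [← div_eq_mul_inv, div_le_iff₀ hp0]; exact h s hs
      rw [h1]
      nlinarith
  have hd : 0 < (1 - p) * k := mul_pos (by linarith) hk
  -- The time at which the linear upper bound for `φ^(1 - p)` reaches zero.
  set s := S + φ S ^ (1 - p) / ((1 - p) * k) with hs
  have hSs : S ≤ s := by
    have := Real.rpow_nonneg (hpos S le_rfl).le (1 - p)
    rw [hs]; linarith [div_nonneg this hd.le]
  have h1 := hanti self_mem_Ici hSs hSs
  have h2 : (1 - p) * k * s = (1 - p) * k * S + φ S ^ (1 - p) := by
    rw [hs, mul_add, mul_div_cancel₀ _ hd.ne']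
  have h3 := Real.rpow_pos_of_pos (hpos s hSs) (1 - p)
  dsimp only at h1
  linarith

/-- If `φ > 0` and `φ' ≤ -k φ^p` with `p > 1`, then `φ^(1 - p)` grows at least linearly. -/
theorem add_le_rpow_of_hasDerivAt_le_rpow {p : ℝ} (hp : 1 < p)
    (hφ : ∀ s ≥ S, HasDerivAt φ (φ' s) s) (hpos : ∀ s ≥ S, 0 < φ s)
    (h : ∀ s ≥ S, φ' s ≤ -k * φ s ^ p) :
    ∀ s ≥ S, (p - 1) * k * (s - S) ≤ φ s ^ (1 - p) := by
  intro s hs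
  have hanti := antitoneOn_Ici_of_hasDerivAt_nonpos
    (f := fun s => (p - 1) * k * s - φ s ^ (1 - p)) (S := S)
    (fun s hs => ((hasDerivAt_id s).const_mul ((p - 1) * k)).sub
      ((hφ s hs).rpow_const (Or.inl (hpos s hs).ne'))) fun s hs => by
      have h1 : φ s ^ (1 - p - 1) = (φ s ^ p)⁻¹ := by
        rw [← Real.rpow_neg (hpos s hs).le]; congr 1; ring
      have hp0 := Real.rpow_pos_of_pos (hpos s hs) p
      have h2 : φ' s * (φ s ^ p)⁻¹ ≤ -k := by
        rw [← div_eq_mul_inv, div_le_iff₀ hp0]; exact h s hs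
      rw [h1]
      nlinarith
  have h1 := hanti self_mem_Ici hs hs
  have h2 := Real.rpow_nonneg (hpos S le_rfl).le (1 - p)
  dsimp only at h1
  linarith

/-- Linear decay rate of the trajectory for the exponent `1 / 2`. -/
theorem exists_norm_sub_le_exp (hk : 0 < k) (hM : 0 < M)
    (hφ : ∀ s ≥ S, HasDerivAt φ (φ' s) s)
    (h : ∀ s ≥ S, 0 < φ s ∧ φ' s ≤ -k * φ s ^ (2 * (1 / 2 : ℝ)) ∧
      ‖y s - ybar‖ ≤ M * φ s ^ (1 - 1 / 2 : ℝ)) :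
    ∃ a > 0, ∃ b > 0, ∀ s ≥ S, ‖y s - ybar‖ ≤ a * Real.exp (-b * s) := by
  have hexp := le_mul_exp_of_hasDerivAt_le hφ (α := k) fun s hs => by
    simpa using (h s hs).2.1
  set D := φ S * Real.exp (k * S) with hD
  have hD0 : 0 < D := mul_pos (h S le_rfl).1 (Real.exp_pos _)
  refine ⟨M * D ^ (1 / 2 : ℝ), by positivity, k / 2, by positivity, fun s hs => ?_⟩
  have hφs := (h s hs).1
  calc ‖y s - ybar‖ ≤ M * φ s ^ (1 - 1 / 2 : ℝ) := (h s hs).2.2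
    _ = M * φ s ^ (1 / 2 : ℝ) := by norm_num
    _ ≤ M * (D * Real.exp (-k * s)) ^ (1 / 2 : ℝ) := by gcongr; exact hexp s hs
    _ = M * D ^ (1 / 2 : ℝ) * Real.exp (-(k / 2) * s) := by
      rw [Real.mul_rpow hD0.le (Real.exp_pos _).le, ← Real.exp_mul, mul_assoc]
      ring_nf

/-- Sublinear decay rate of the trajectory for exponents in `(1 / 2, 1)`. -/
theorem exists_norm_sub_le_rpow (hk : 0 < k) (hM : 0 < M) (hθ : θ ∈ Ioo (1 / 2 : ℝ) 1)
    (hφ : ∀ s ≥ S, HasDerivAt φ (φ' s) s)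
    (h : ∀ s ≥ S, 0 < φ s ∧ φ' s ≤ -k * φ s ^ (2 * θ) ∧ ‖y s - ybar‖ ≤ M * φ s ^ (1 - θ)) :
    ∃ a > 0, ∃ b > 0, ∃ R, ∀ s ≥ R,
      ‖y s - ybar‖ ≤ (a * s + b) ^ (-((1 - θ) / (2 * θ - 1))) := by
  obtain ⟨hθ1, hθ2⟩ := hθ
  have hp : 0 < 2 * θ - 1 := by linarith
  have hq : 0 < 1 - θ := by linarith
  have hgrow := add_le_rpow_of_hasDerivAt_le_rpow (p := 2 * θ) (k := k) (by linarith) hφ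
    (fun s hs => (h s hs).1) fun s hs => (h s hs).2.1
  set β := (1 - θ) / (2 * θ - 1) with hβ
  have hβ0 : 0 < β := by positivity
  -- Chosen so that `N ^ (-β) = M`: the prefactor is absorbed into the base of the power.
  set N := M ^ (-β⁻¹) with hN
  have hN0 : 0 < N := by positivity
  have hNM : N ^ (-β) = M := by
    rw [hN, ← Real.rpow_mul hM.le]
    field_simp
    simp
  -- For `s ≥ 2 S + 2` one has `s - S ≥ s / 2 + 1`, which keeps the additive constant positive.
  refine ⟨N * ((2 * θ - 1) * k) / 2, by positivity, N * ((2 * θ - 1) * k), by positivity,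
    max S (max 0 (2 * S + 2)), fun s hs => ?_⟩
  have hsS : S ≤ s := le_of_max_le_left hs
  have hs0 : 0 ≤ s := le_of_max_le_left (le_of_max_le_right hs)
  have hs2 : 2 * S + 2 ≤ s := le_of_max_le_right (le_of_max_le_right hs)
  have hφs := (h s hsS).1
  have hlin : (2 * θ - 1) * k * (s / 2 + 1) ≤ φ s ^ (1 - 2 * θ) :=
    le_trans (by gcongr; linarith) (hgrow s hsS)
  have hφβ : φ s ^ (1 - θ) = (φ s ^ (1 - 2 * θ)) ^ (-β) := by
    rw [← Real.rpow_mul hφs.le]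
    congr 1
    rw [hβ, mul_neg, ← neg_mul, neg_sub, mul_div_cancel₀ _ hp.ne']
  calc ‖y s - ybar‖ ≤ M * φ s ^ (1 - θ) := (h s hsS).2.2
    _ ≤ M * ((2 * θ - 1) * k * (s / 2 + 1)) ^ (-β) := by
      rw [hφβ]
      gcongr ?_ * ?_
      exact Real.rpow_le_rpow_of_nonpos (by positivity) hlin (by linarith)
    _ = (N * ((2 * θ - 1) * k * (s / 2 + 1))) ^ (-β) := by
      rw [Real.mul_rpow hN0.le (by positivity), hNM]
    _ = _ := by congr 1; ring

end Rates

/-! ### Energy of the damped system. -/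

/-- Pointwise dissipation of the energy: here `G = ∇ g y` and `G + D = ∇ g (y + δ v)`. -/
theorem exists_energy_decay {E : Type*} [NormedAddCommGroup E] [InnerProductSpace ℝ E]
    {lam gam : ℝ} (L Γ : ℝ) (hL : 0 ≤ L) (hlam : 0 < lam) (hgam : 0 < gam)
    (hΓ : 0 ≤ Γ) :
    ∃ δ > 0, ∃ c > 0, ∀ (v G D : E) (a : ℝ), gam ≤ a → a ≤ Γ → ‖D‖ ≤ L * (δ * ‖v‖) →
      inner ℝ (G + D) (v + δ • -((1 / lam) • (a • v + G)))
        + lam * inner ℝ v (-((1 / lam) • (a • v + G))) ≤ -c * (‖v‖ + ‖G‖) ^ 2 := by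
  -- `δ N` bounds the coefficient of `‖v‖²` produced by the cross terms after Young's inequality; `δ
  -- ≤ gam / (2 N)` leaves half of the damping.
  set N := L + L * Γ / lam + (L + Γ) ^ 2 / (2 * lam) + 1 with hN
  have hN0 : 0 < N := by positivity
  set δ := min 1 (gam / (2 * N)) with hδ
  have hδ0 : 0 < δ := by positivity
  have hδ1 : δ ≤ 1 := min_le_left _ _
  have hδN : δ * N ≤ gam / 2 := by
    calc δ * N ≤ gam / (2 * N) * N := by gcongr; exact min_le_right _ _
      _ = gam / 2 := by field_simp
  refine ⟨δ, hδ0, min (gam / 4) (δ / (4 * lam)), by positivity, fun v G D a ha haΓ hD => ?_⟩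
  set p := ‖v‖ with hp
  set q := ‖G‖ with hq
  have hp0 : 0 ≤ p := norm_nonneg _
  have hq0 : 0 ≤ q := norm_nonneg _
  have ha0 : 0 ≤ a := hgam.le.trans ha
  have hGv : -(a * inner ℝ G v) ≤ Γ * (p * q) := by
    have h1 := (abs_le.1 (abs_real_inner_le_norm G v)).1
    calc -(a * inner ℝ G v) = a * -inner ℝ G v := by ring
      _ ≤ a * (p * q) := by gcongr; rw [hp, hq]; linarith
      _ ≤ Γ * (p * q) := by gcongr
  have hw : ‖v + δ • -((1 / lam) • (a • v + G))‖ ≤ p + δ * (1 / lam * (Γ * p + q)) := by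
    refine (norm_add_le _ _).trans ?_
    rw [norm_smul, norm_neg, norm_smul, Real.norm_of_nonneg hδ0.le,
      Real.norm_of_nonneg (by positivity : 0 ≤ 1 / lam)]
    gcongr
    refine (norm_add_le _ _).trans ?_
    rw [norm_smul, Real.norm_of_nonneg ha0]
    gcongr
  have hDw : inner ℝ D (v + δ • -((1 / lam) • (a • v + G)))
      ≤ L * (δ * p) * (p + δ * (1 / lam * (Γ * p + q))) :=
    (real_inner_le_norm _ _).trans (by gcongr)
  -- The two terms `⟨G, v⟩` cancel, and the shift by `δ v` contributes `-(δ / lam) ‖G‖²`.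
  have hexpand : inner ℝ (G + D) (v + δ • -((1 / lam) • (a • v + G)))
        + lam * inner ℝ v (-((1 / lam) • (a • v + G)))
      = inner ℝ D (v + δ • -((1 / lam) • (a • v + G)))
        + δ / lam * (-(a * inner ℝ G v) - q ^ 2) - a * p ^ 2 := by
    rw [inner_add_left]
    simp only [inner_add_right, inner_smul_right, inner_neg_right, real_inner_self_eq_norm_sq,
      real_inner_comm G v]
    rw [← hp, ← hq]
    field_simp
    ring
  rw [hexpand]
  have hstep : δ / lam * (-(a * inner ℝ G v) - q ^ 2) ≤ δ / lam * (Γ * (p * q) - q ^ 2) := by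
    gcongr
  have hap : gam * p ^ 2 ≤ a * p ^ 2 := by gcongr
  have hpq : (L + Γ) * (p * q) ≤ q ^ 2 / 2 + (L + Γ) ^ 2 * p ^ 2 / 2 := by
    nlinarith [sq_nonneg (q - (L + Γ) * p)]
  have hmain : L * (δ * p) * (p + δ * (1 / lam * (Γ * p + q))) + δ / lam * (Γ * (p * q) - q ^ 2)
      ≤ δ * N * p ^ 2 - δ / (2 * lam) * q ^ 2 := by
    have h1 : L * (δ * p) * (p + δ * (1 / lam * (Γ * p + q)))
        ≤ L * (δ * p) * (p + 1 * (1 / lam * (Γ * p + q))) := by gcongr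
    have h2 : δ / lam * ((L + Γ) * (p * q))
        ≤ δ / lam * (q ^ 2 / 2 + (L + Γ) ^ 2 * p ^ 2 / 2) := by gcongr
    have h3 : L * (δ * p) * (p + 1 * (1 / lam * (Γ * p + q))) + δ / lam * (Γ * (p * q) - q ^ 2)
        = δ * (L + L * Γ / lam) * p ^ 2 + δ / lam * ((L + Γ) * (p * q)) - δ / lam * q ^ 2 := by
      field_simp; ring
    have h4 : δ * N * p ^ 2 - δ / (2 * lam) * q ^ 2 = δ * (L + L * Γ / lam) * p ^ 2
        + δ / lam * (q ^ 2 / 2 + (L + Γ) ^ 2 * p ^ 2 / 2) - δ / lam * q ^ 2 + δ * p ^ 2 := by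
      rw [hN]; field_simp; ring
    have : 0 ≤ δ * p ^ 2 := by positivity
    linarith
  have hNp : δ * N * p ^ 2 ≤ gam / 2 * p ^ 2 := by gcongr
  have hc : min (gam / 4) (δ / (4 * lam)) * (p + q) ^ 2
      ≤ gam / 2 * p ^ 2 + δ / (2 * lam) * q ^ 2 := by
    calc min (gam / 4) (δ / (4 * lam)) * (p + q) ^ 2
        ≤ min (gam / 4) (δ / (4 * lam)) * (2 * p ^ 2 + 2 * q ^ 2) := by
          gcongr; nlinarith [sq_nonneg (p - q)]
      _ = min (gam / 4) (δ / (4 * lam)) * (2 * p ^ 2)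
          + min (gam / 4) (δ / (4 * lam)) * (2 * q ^ 2) := by ring
      _ ≤ gam / 4 * (2 * p ^ 2) + δ / (4 * lam) * (2 * q ^ 2) := by
          gcongr
          · exact min_le_left _ _
          · exact min_le_right _ _
      _ = _ := by ring
  linarith

section Lyapunov

variable {E : Type*} [NormedAddCommGroup E] [InnerProductSpace ℝ E] [CompleteSpace E]
  {g : E → ℝ} {L : ℝ≥0} {lam gam Γ S : ℝ} {a : ℝ → ℝ} {y v : ℝ → E} {ybar : E}

/-- The velocity of a convergent trajectory of a damped second-order gradient system vanishes at
infinity. -/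
theorem tendsto_velocity_zero (hgc : Continuous (∇ g)) (hlam : 0 < lam) (hgam : 0 < gam)
    (ha : ∀ s ≥ S, gam ≤ a s)
    (hv : ∀ s ≥ S, HasDerivAt v (-((1 / lam) • (a s • v s + ∇ g (y s)))) s)
    (hy : Tendsto y atTop (𝓝 ybar)) (hcrit : ∇ g ybar = 0) : Tendsto v atTop (𝓝 0) := by
  have hG : Tendsto (fun s => ‖∇ g (y s)‖ ^ 2 / (lam * gam)) atTop (𝓝 0) := by
    simpa [hcrit] using (((hgc.tendsto ybar).comp hy).norm.pow 2).div_const (lam * gam)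
  have hsq := tendsto_zero_of_hasDerivAt_le (q := fun s => ‖v s‖ ^ 2) (α := gam / lam)
    (by positivity) (fun s => by positivity) (fun s hs => (hv s hs).norm_sq) (fun s hs => by
      have hi := abs_le.1 (abs_real_inner_le_norm (v s) (∇ g (y s)))
      have h1 := mul_le_mul_of_nonneg_right (ha s hs) (sq_nonneg ‖v s‖)
      have h3 : 2 * (‖v s‖ * ‖∇ g (y s)‖) ≤ gam * ‖v s‖ ^ 2 + ‖∇ g (y s)‖ ^ 2 / gam := by
        have h4 : (gam * ‖v s‖ - ‖∇ g (y s)‖) ^ 2 / gam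
            = gam * ‖v s‖ ^ 2 + ‖∇ g (y s)‖ ^ 2 / gam - 2 * (‖v s‖ * ‖∇ g (y s)‖) := by
          field_simp; ring
        have : 0 ≤ (gam * ‖v s‖ - ‖∇ g (y s)‖) ^ 2 / gam := by positivity
        linarith
      rw [inner_neg_right, inner_smul_right, inner_add_right, inner_smul_right,
        real_inner_self_eq_norm_sq]
      have h5 : -(2 * a s * ‖v s‖ ^ 2) - 2 * inner ℝ (v s) (∇ g (y s))
          ≤ -gam * ‖v s‖ ^ 2 + ‖∇ g (y s)‖ ^ 2 / gam := by linarith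
      have h6 := mul_le_mul_of_nonneg_left h5 (one_div_pos.2 hlam).le
      calc _ = 1 / lam * (-(2 * a s * ‖v s‖ ^ 2) - 2 * inner ℝ (v s) (∇ g (y s))) := by ring
        _ ≤ _ := h6
        _ = _ := by field_simp) hG
  have := hsq.sqrt
  simp only [Real.sqrt_sq (norm_nonneg _), Real.sqrt_zero] at this
  exact tendsto_zero_iff_norm_tendsto_zero.2 this

/-- Derivative of the energy `g (y + δ v) + (lam / 2) ‖v‖²` along a curve. -/
theorem hasDerivAt_energy (hg : Differentiable ℝ g) {v' : E} {δ s : ℝ} (e : ℝ)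
    (hy : HasDerivAt y (v s) s) (hv : HasDerivAt v v' s) :
    HasDerivAt (fun s => g (y s + δ • v s) + lam / 2 * ‖v s‖ ^ 2 - e)
      (inner ℝ (∇ g (y s + δ • v s)) (v s + δ • v') + lam * inner ℝ (v s) v') s := by
  have h1 := (hg (y s + δ • v s)).hasFDerivAt.comp_hasDerivAt s (hy.add (hv.const_smul δ))
  have h2 := (hv.norm_sq).const_mul (lam / 2)
  convert! (h1.add h2).sub_const e using 1
  rw [inner_gradient_left]
  ring

/-- The Łojasiewicz dichotomy for a convergent trajectory of
`lam y'' + a(s) y' + ∇ g (y) = 0` with damping bounded above and away from zero. -/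
theorem exists_lyapunov_of_damped_gradient_system {θ : ℝ} (hθ : θ ∈ Ioo (0 : ℝ) 1)
    (hg : Differentiable ℝ g) (hgL : LipschitzWith L (∇ g)) (hlam : 0 < lam) (hgam : 0 < gam)
    (ha : ∀ s ≥ S, gam ≤ a s) (haΓ : ∀ s ≥ S, a s ≤ Γ)
    (hy : ∀ s ≥ S, HasDerivAt y (v s) s)
    (hv : ∀ s ≥ S, HasDerivAt v (-((1 / lam) • (a s • v s + ∇ g (y s)))) s)
    (hylim : Tendsto y atTop (𝓝 ybar)) (hcrit : ∇ g ybar = 0)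
    (hH : ∃ K > (0 : ℝ), ∃ ε > (0 : ℝ), ∀ u w : E, ‖u - ybar‖ < ε → ‖w‖ < ε →
      |g u + 1 / 2 * ‖w‖ ^ 2 - g ybar| ^ θ ≤ K * (‖∇ g u‖ + ‖w‖)) :
    (∃ T, ∀ s ≥ T, y s = ybar) ∨
      ∃ (φ φ' : ℝ → ℝ) (R k M : ℝ), 0 < k ∧ 0 < M ∧ (∀ s ≥ R, HasDerivAt φ (φ' s) s) ∧
        ∀ s ≥ R, 0 < φ s ∧ φ' s ≤ -k * φ s ^ (2 * θ) ∧ ‖y s - ybar‖ ≤ M * φ s ^ (1 - θ) := by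
  obtain ⟨K, hK, ε, hε, hH⟩ := hH
  have hvlim := tendsto_velocity_zero hgL.continuous hlam hgam ha hv hylim hcrit
  have hΓ : 0 ≤ Γ := hgam.le.trans ((ha S le_rfl).trans (haΓ S le_rfl))
  obtain ⟨δ, hδ, c, hc, hdecay⟩ := exists_energy_decay (E := E) (L : ℝ) Γ L.2 hlam hgam hΓ
  have hz : Tendsto (fun s => y s + δ • v s) atTop (𝓝 ybar) := by
    simpa using hylim.add (hvlim.const_smul δ)
  -- With `w = √lam v`, `½ ‖w‖²` is the kinetic term, so `φ` is the quantity in `hH` at `u = y + δ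
  -- v`.
  have hw : Tendsto (fun s => √lam • v s) atTop (𝓝 0) := by
    simpa using hvlim.const_smul (√lam)
  have hD : ∀ s, ‖∇ g (y s + δ • v s) - ∇ g (y s)‖ ≤ L * (δ * ‖v s‖) := fun s => by
    have := hgL.norm_sub_le (y s + δ • v s) (y s)
    rwa [add_sub_cancel_left, norm_smul, Real.norm_of_nonneg hδ.le] at this
  have hev : ∀ᶠ s in atTop, ‖y s + δ • v s - ybar‖ < ε ∧ ‖√lam • v s‖ < ε := by
    refine Eventually.and ?_ ?_
    · have := (tendsto_iff_norm_sub_tendsto_zero.1 hz).eventually_lt_const hε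
      exact this
    · have := hw.norm
      rw [norm_zero] at this
      exact this.eventually_lt_const hε
  obtain ⟨R, hR⟩ := eventually_atTop.1 hev
  set φ : ℝ → ℝ := fun s => g (y s + δ • v s) + lam / 2 * ‖v s‖ ^ 2 - g ybar with hφdef
  have hφ : ∀ s ≥ max S R, HasDerivAt φ _ s := fun s hs =>
    hasDerivAt_energy hg (g ybar) (hy s (le_of_max_le_left hs)) (hv s (le_of_max_le_left hs))
  have hφ0 : Tendsto φ atTop (𝓝 0) := by
    have := (((hg.continuous.tendsto ybar).comp hz).add
      ((hvlim.norm.pow 2).const_mul (lam / 2))).sub_const (g ybar)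
    simpa using this
  set C := K * (1 + L * δ + √lam) with hCdef
  have hC : 0 < C := by positivity
  refine (eventually_eq_or_forall_norm_sub_le (m := fun s => ‖v s‖ + ‖∇ g (y s)‖) hc hC hθ hφ
    (fun s hs => ?_) (fun s hs => ?_) (fun s hs => hy s (le_of_max_le_left hs))
    (fun s _ => by simp) hφ0 hylim).imp_right fun h =>
      ⟨φ, _, max S R, c / C ^ 2, C / (c * (1 - θ)), by positivity, ?_, hφ, h⟩
  · have := hdecay (v s) (∇ g (y s)) (∇ g (y s + δ • v s) - ∇ g (y s)) (a s)
      (ha s (le_of_max_le_left hs)) (haΓ s (le_of_max_le_left hs)) (hD s)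
    rwa [add_sub_cancel] at this
  · obtain ⟨h1, h2⟩ := hR s (le_of_max_le_right hs)
    have h3 := hH _ _ h1 h2
    rw [norm_smul, Real.norm_of_nonneg (Real.sqrt_nonneg _), mul_pow, Real.sq_sqrt hlam.le,
      ← mul_assoc, one_div_mul_eq_div] at h3
    refine h3.trans ?_
    rw [hCdef, mul_assoc]
    gcongr
    have h4 : ‖∇ g (y s + δ • v s)‖ ≤ ‖∇ g (y s)‖ + L * (δ * ‖v s‖) := by
      have := norm_add_le (∇ g (y s)) (∇ g (y s + δ • v s) - ∇ g (y s))
      rw [add_sub_cancel] at this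
      exact this.trans (by gcongr; exact hD s)
    have h5 : 0 ≤ (L * δ + √lam) * ‖∇ g (y s)‖ := by positivity
    linarith [norm_nonneg (v s)]
  · exact div_pos hC (mul_pos hc (sub_pos.2 hθ.2))

end Lyapunov

/-! ### The change of time. -/

theorem hasDerivAt_sqrt_two_mul {s : ℝ} (hs : 0 < s) :
    HasDerivAt (fun s => √(2 * s)) (1 / √(2 * s)) s := by
  have := ((hasDerivAt_id s).const_mul 2).sqrt (by simpa using hs.ne')
  convert! this using 1
  rw [id, mul_one, div_mul_cancel_left₀ two_ne_zero, one_div]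

namespace IsStrongGlobalSolution

variable {n : ℕ} {g : Rn n → ℝ} {lam gam t₀ : ℝ} {u₀ v₀ : Rn n} {x : ℝ → Rn n}

/-- In the time scale `s = t² / 2` the velocity is `x'(t) / t`. -/
theorem hasDerivAt_comp_sqrt (hx : IsStrongGlobalSolution g lam gam t₀ u₀ v₀ x) {s : ℝ}
    (hs : 0 < s) (ht : t₀ < √(2 * s)) :
    HasDerivAt (fun s => x √(2 * s)) ((1 / √(2 * s)) • dot t₀ x √(2 * s)) s :=
  (hx.hasDerivAt ht).scomp s (hasDerivAt_sqrt_two_mul hs)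

/-- In the time scale `s = t² / 2` the system has constant mass `lam` and damping
`gam + lam / (2 s)`. -/
theorem hasDerivAt_velocity_comp_sqrt (hx : IsStrongGlobalSolution g lam gam t₀ u₀ v₀ x)
    (hg : Continuous (∇ g)) (ht₀ : 0 < t₀) (hlam : 0 < lam) {s : ℝ} (hs : 0 < s)
    (ht : t₀ < √(2 * s)) :
    HasDerivAt (fun s => (1 / √(2 * s)) • dot t₀ x √(2 * s))
      (-((1 / lam) • ((gam + lam / (2 * s)) • (1 / √(2 * s)) • dot t₀ x √(2 * s)
        + ∇ g (x √(2 * s))))) s := by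
  have hr := hasDerivAt_sqrt_two_mul hs
  have hode := hx.ode_of_lt hg ht₀ ht
  have hinv := hr.inv (ht₀.trans ht).ne'
  have hder := hinv.smul ((hx.hasDerivAt_dot ht).scomp s hr)
  have h2s : 2 * s = √(2 * s) ^ 2 := (Real.sq_sqrt (by positivity)).symm
  simp only [one_div]
  convert! hder using 1
  set r := √(2 * s) with hrdef
  have hr0 : r ≠ 0 := (ht₀.trans ht).ne'
  rw [h2s, eq_neg_of_add_eq_zero_right hode]
  simp only [Function.comp_apply, Pi.inv_apply, ← hrdef]
  match_scalars <;> field_simp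
  ring

end IsStrongGlobalSolution

/-! ### The convergence rates. -/

theorem theorem5p1 (n : ℕ) (g : Rn n → ℝ) (L : ℝ≥0)
    (hg : Differentiable ℝ g) (hgL : LipschitzWith L (∇ g)) (hgb : BddBelow (range g))
    (lam gam t₀ : ℝ) (hlam : 0 < lam) (hgam : 0 < gam) (ht₀ : 0 < t₀)
    (u₀ v₀ : Rn n) (x : ℝ → Rn n) (hx : IsStrongGlobalSolution g lam gam t₀ u₀ v₀ x)
    (hxb : Bornology.IsBounded (x '' Ici t₀))
    (xbar : Rn n) (hcrit : xbar ∈ crit g) (hlim : Tendsto x atTop (𝓝 xbar))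
    (θ : ℝ) (hH : LojasiewiczAt (regularization g) (WithLp.toLp 2 (xbar, xbar)) θ) :
    ∃ a₁ > (0 : ℝ), ∃ a₂ > (0 : ℝ), ∃ a₃ > (0 : ℝ), ∃ a₄ > (0 : ℝ), ∃ t' > (0 : ℝ), t₀ ≤ t' ∧
      ∀ t ≥ t',
        (θ ∈ Ioo (0 : ℝ) (1 / 2) → ConvergesInFiniteTime t₀ x xbar) ∧
        (θ = 1 / 2 → ‖x t - xbar‖ ≤ a₁ * Real.exp (-a₂ * t ^ 2)) ∧
        (θ ∈ Ioo (1 / 2 : ℝ) 1 →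
          ‖x t - xbar‖ ≤ (a₃ * t ^ 2 + a₄) ^ (-((1 - θ) / (2 * θ - 1)))) := by
  -- The extra `1` keeps `√(2 s) > t₀` strictly, where two-sided derivatives exist.
  set S : ℝ := t₀ ^ 2 / 2 + 1 with hS
  have hS0 : 0 < S := by positivity
  have hs0 : ∀ s ≥ S, 0 < s := fun s hs => hS0.trans_le hs
  have hst : ∀ s ≥ S, t₀ < √(2 * s) := fun s hs => Real.lt_sqrt_of_sq_lt (by linarith)
  have hylim : Tendsto (fun s => x √(2 * s)) atTop (𝓝 xbar) :=
    hlim.comp (Real.tendsto_sqrt_atTop.comp (tendsto_id.const_mul_atTop two_pos))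
  have hback : ∀ t ≥ t₀, x √(2 * (t ^ 2 / 2)) = x t := fun t ht => by
    rw [mul_div_cancel₀ _ two_ne_zero, Real.sqrt_sq (ht₀.le.trans ht)]
  have hlarge : ∀ R t : ℝ, t ≥ max t₀ (2 * R + 1) → t ^ 2 / 2 ≥ R := fun R t ht => by
    have := le_of_max_le_right ht
    nlinarith [sq_nonneg (t - 1)]
  have hpos : ∀ R : ℝ, 0 < max t₀ (2 * R + 1) := fun R => ht₀.trans_le (le_max_left _ _)
  obtain ⟨T, hT⟩ | ⟨φ, φ', R, k, M, hk, hM, hφ, h⟩ :=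
    exists_lyapunov_of_damped_gradient_system hH.exponent_mem hg hgL hlam hgam
      (a := fun s => gam + lam / (2 * s)) (Γ := gam + lam / (2 * S)) (S := S)
      (fun s hs => by have := hs0 s hs; simp only [le_add_iff_nonneg_right]; positivity)
      (fun s hs => by gcongr)
      (fun s hs => hx.hasDerivAt_comp_sqrt (hs0 s hs) (hst s hs))
      (fun s hs => hx.hasDerivAt_velocity_comp_sqrt hgL.continuous ht₀ hlam (hs0 s hs) (hst s hs))
      hylim hcrit (hH.exists_forall_abs_rpow_le hg)
  · have hfin : ∀ t ≥ max t₀ (2 * T + 1), x t = xbar := fun t ht => by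
      rw [← hback t (le_of_max_le_left ht)]
      exact hT _ (hlarge T t ht)
    refine ⟨1, one_pos, 1, one_pos, 1, one_pos, 1, one_pos, _, hpos T, le_max_left _ _,
      fun t ht => ⟨fun _ => ⟨_, le_max_left _ _, hfin⟩, fun _ => ?_, fun _ => ?_⟩⟩ <;>
    · rw [hfin t ht, sub_self, norm_zero]
      positivity
  · rcases lt_trichotomy θ (1 / 2) with hθ | hθ | hθ
    -- Here `2 θ < 1`, so `φ` would reach zero in finite time; only the finite-time branch survives.
    · exact (false_of_hasDerivAt_le_rpow hk (by linarith) hφ (fun s hs => (h s hs).1)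
        fun s hs => (h s hs).2.1).elim
    · rw [hθ] at h
      obtain ⟨a, ha, b, hb, hab⟩ := exists_norm_sub_le_exp hk hM hφ h
      refine ⟨a, ha, b / 2, by positivity, 1, one_pos, 1, one_pos, _, hpos R, le_max_left _ _,
        fun t ht => ⟨fun h' => absurd h'.2 (by linarith), fun _ => ?_,
          fun h' => absurd h'.1 (by linarith)⟩⟩
      have := hab _ (hlarge R t ht)
      rw [hback t (le_of_max_le_left ht)] at this
      convert this using 3
      ring
    · obtain ⟨a, ha, b, hb, Q, hab⟩ :=
        exists_norm_sub_le_rpow hk hM ⟨hθ, hH.exponent_mem.2⟩ hφ h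
      refine ⟨1, one_pos, 1, one_pos, a / 2, by positivity, b, hb, _, hpos Q, le_max_left _ _,
        fun t ht => ⟨fun h' => absurd h'.2 (by linarith), fun h' => absurd h' (by linarith),
          fun _ => ?_⟩⟩
      have := hab _ (hlarge Q t ht)
      rw [hback t (le_of_max_le_left ht)] at this
      convert this using 3
      ring
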